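/- Let $A$ be a (not necessarily unital) C*-algebra with multiplier algebra $M(A)$. A linear operator $T:\mathcal D(T)\to A$ with dense domain $\mathcal D(T)\subset A$ is called affiliated with $A$ if there is $z\in M(A)$ with $\|z\|\le 1$ such that for all $x,y\in A$: $x\in\mathcal D(T)$ and $y=Tx$ if and only if there is $a\in A$ with $x=(1-z^*z)^{1/2}a$ and $y=za$. Such a $z$ is unique; it is called the $z$-transform of $T$ and denoted by $z(T)$. For $s>0$ put $z_s(T)=z(sT)$. The adjoint $T^*$ is the operator whose graph consists of all pairs $(y,w)\in A\times A$ with $(Tx)^*y=x^*w$ for all $x\in\mathcal D(T)$. The element $T$ is normal if $T^*\circ T=T\circ T^*$, where $X\circ Y$ has the domain $\{a\in\mathcal D(Y):Ya\in\mathcal D(X)\}$. Let $p,q>0$ be real numbers and let $(R,S)$ be a $(p^2,q^2)$-commuting pair of normal elements affiliated with $A$, that is, $R$ and $S$ are normal, affiliated with $A$, and 1. $z(R)\,z(S^*)=z_{pq}(S^*)\,z_{q/p}(R)$, 2. $z_{q/p}(R)\,z(S)=z_{pq}(S)\,z(R)$. Then the operator $R\circ S:\mathcal D(R\circ S)\to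 A$, $\mathcal D(R\circ S)=\{a\in\mathcal D(S):Sa\in\mathcal D(R)\}$, is closable, and its closure $RS$ is affiliated with $A$. -/

import Mathlib

open scoped MultiplierAlgebra

namespace CStarAffiliated

/-- The composition `R ∘ S` of two partially defined linear operators on its natural domain
`{x ∈ D(S) | S x ∈ D(R)}`. -/
def opComp {A : Type*} [AddCommGroup A] [Module ℂ A] (R S : A →ₗ.[ℂ] A) : A →ₗ.[ℂ] A where
  domain := (R.domain.comap S.toFun).map S.domain.subtype
  toFun :=
    { toFun := fun x =>
        R ⟨S ⟨(x : A), Submodule.map_subtype_le _ _ x.2⟩, by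
          obtain ⟨x, y, hy, rfl⟩ := x
          exact hy⟩
      map_add' := by
        intro x y
        rw [← R.map_add]
        congr 1
        apply Subtype.ext
        exact S.map_add ⟨x, Submodule.map_subtype_le _ _ x.2⟩ ⟨y, Submodule.map_subtype_le _ _ y.2⟩
      map_smul' := by
        intro c x
        rw [RingHom.id_apply, ← R.map_smul]
        congr 1
        apply Subtype.ext
        exact S.map_smul c ⟨x, Submodule.map_subtype_le _ _ x.2⟩ }

theorem mem_graph_opComp {A : Type*} [AddCommGroup A] [Module ℂ A] (R S : A →ₗ.[ℂ] A)
    (x y : A) : (x, y) ∈ (opComp R S).graph ↔ ∃ w, (x, w) ∈ S.graph ∧ (w, y) ∈ R.graph := by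
  simp only [LinearPMap.mem_graph_iff]
  constructor
  · rintro ⟨⟨_, u, hu, rfl⟩, rfl, rfl⟩
    exact ⟨S u, ⟨u, rfl, rfl⟩, ⟨S u, hu⟩, rfl, rfl⟩
  · rintro ⟨w, ⟨u, rfl, rfl⟩, ⟨v, hv, rfl⟩⟩
    refine ⟨⟨u, u, ?_, rfl⟩, rfl, ?_⟩
    · change S u ∈ R.domain
      rw [← hv]
      exact v.2
    · change R _ = R v
      congr 1
      exact Subtype.ext hv.symm

section CStar

variable {A : Type*} [NonUnitalCStarAlgebra A]

/-- The graph of the adjoint: the pairs `(y, w)` with `(T x)^* y = x^* w` for all `x ∈ D(T)`. -/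
def adjointGraph (T : A →ₗ.[ℂ] A) : Submodule ℂ (A × A) where
  carrier := {p | ∀ x : T.domain, star (T x) * p.1 = star (x : A) * p.2}
  add_mem' := by
    intro p q hp hq x
    simp only [Prod.fst_add, Prod.snd_add, mul_add, hp x, hq x]
  zero_mem' := by
    intro x
    simp
  smul_mem' := by
    intro c p hp x
    simp only [Prod.smul_fst, Prod.smul_snd, mul_smul_comm, hp x]

/-- The adjoint `T^*` of a densely defined operator `T` on the C*-algebra `A`, for the `A`-valued
inner product `⟨x, y⟩ = x^* y`: its graph is `adjointGraph T`. -/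
noncomputable def opAdjoint (T : A →ₗ.[ℂ] A) : A →ₗ.[ℂ] A := (adjointGraph T).toLinearPMap

theorem graph_opAdjoint (T : A →ₗ.[ℂ] A) (hT : Dense (T.domain : Set A)) :
    (opAdjoint T).graph = adjointGraph T := by
  apply Submodule.toLinearPMap_graph_eq
  rintro ⟨y, w⟩ hw hy
  change y = 0 at hy
  subst hy
  have h0 : ∀ x ∈ (T.domain : Set A), star x * w = 0 := by
    intro x hx
    simpa using (hw ⟨x, hx⟩).symm
  have hcl : IsClosed {x : A | star x * w = 0} :=
    isClosed_eq (continuous_star.mul continuous_const) continuous_const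
  have h1 : w ∈ {x : A | star x * w = 0} :=
    hcl.closure_subset_iff.mpr h0 (hT w)
  exact (CStarRing.star_mul_self_eq_zero_iff w).mp h1

/-- `(1 - z^* z)^{1/2}` in the multiplier algebra `M(A)`, for a contraction `z`. -/
noncomputable def defect (z : 𝓜(ℂ, A)) : 𝓜(ℂ, A) := cfc Real.sqrt (1 - star z * z)

/-- `z ∈ M(A)` is a `z`-transform of the operator `T` on `A`: `‖z‖ ≤ 1`, and the graph of `T` is
`{((1 - z^* z)^{1/2} a, z a) | a ∈ A}`. Here `m.fst a` is the product `m a` of the multiplier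
`m ∈ M(A)` and `a ∈ A`. -/
def IsZTransform (T : A →ₗ.[ℂ] A) (z : 𝓜(ℂ, A)) : Prop :=
  ‖z‖ ≤ 1 ∧ ∀ x y : A, (x, y) ∈ T.graph ↔ ∃ a : A, x = (defect z).fst a ∧ y = z.fst a

/-- `T` is affiliated with `A` in the sense of Woronowicz: `T` is densely defined and has a
`z`-transform in `M(A)`. -/
def IsAffiliated (T : A →ₗ.[ℂ] A) : Prop :=
  Dense (T.domain : Set A) ∧ ∃ z : 𝓜(ℂ, A), IsZTransform T z

open Classical in
/-- The `z`-transform `z(T) ∈ M(A)` of an element `T` affiliated with `A`; it is unique, see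
`IsZTransform.unique`. (It is `0` if there is none.) -/
noncomputable def zTransform (T : A →ₗ.[ℂ] A) : 𝓜(ℂ, A) :=
  if h : ∃ z : 𝓜(ℂ, A), IsZTransform T z then h.choose else 0

/-- `T` is normal: `T^* T = T T^*`, with equality of domains. -/
def IsNormalOp (T : A →ₗ.[ℂ] A) : Prop :=
  opComp (opAdjoint T) T = opComp T (opAdjoint T)

/-- `(R, S)` is a `(p², q²)`-commuting pair of normal elements affiliated with `A`. -/
structure IsCommutingPair (p q : ℝ) (R S : A →ₗ.[ℂ] A) : Prop where
  affiliated_left : IsAffiliated R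
  affiliated_right : IsAffiliated S
  normal_left : IsNormalOp R
  normal_right : IsNormalOp S
  /-- `z(R) z(S^*) = z_{pq}(S^*) z_{q/p}(R)` -/
  comm_adjoint : zTransform R * zTransform (opAdjoint S) =
    zTransform (((p * q : ℝ) : ℂ) • opAdjoint S) * zTransform (((q / p : ℝ) : ℂ) • R)
  /-- `z_{q/p}(R) z(S) = z_{pq}(S) z(R)` -/
  comm : zTransform (((q / p : ℝ) : ℂ) • R) * zTransform S =
    zTransform (((p * q : ℝ) : ℂ) • S) * zTransform R

/-! Uniqueness of the `z`-transform. -/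

theorem zTransform_spec {T : A →ₗ.[ℂ] A} (hT : IsAffiliated T) :
    IsZTransform T (zTransform T) := by
  rw [zTransform, dif_pos hT.2]
  exact hT.2.choose_spec

theorem multiplier_ext {m n : 𝓜(ℂ, A)} (h : ∀ a, m.fst a = n.fst a) : m = n := by
  have h1 : m.fst = n.fst := ContinuousLinearMap.ext h
  have h2 : m.snd = n.snd := by
    ext x
    have h3 : ∀ y, (m.snd x - n.snd x) * y = 0 := by
      intro y
      rw [sub_mul, m.central, n.central, h1, sub_self]
    have h4 := h3 (star (m.snd x - n.snd x))
    exact sub_eq_zero.mp ((CStarRing.mul_star_self_eq_zero_iff _).mp h4)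
  exact DoubleCentralizer.ext ℂ A m n (Prod.ext h1 h2)

theorem star_mul_fst (m : 𝓜(ℂ, A)) (x y : A) :
    star (m.fst x) * y = star x * (star m).fst y := by
  have h := (star m).central (star x) y
  rwa [DoubleCentralizer.star_snd, star_star] at h

theorem star_defect (z : 𝓜(ℂ, A)) : star (defect z) = defect z :=
  (IsSelfAdjoint.cfc : IsSelfAdjoint (cfc Real.sqrt (1 - star z * z)))

theorem defect_mul_self {z : 𝓜(ℂ, A)} (hz : ‖z‖ ≤ 1) :
    defect z * defect z = 1 - star z * z := by
  have hsa : IsSelfAdjoint (1 - star z * z) :=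
    (IsSelfAdjoint.one _).sub (IsSelfAdjoint.star_mul_self z)
  have hspec : ∀ x ∈ spectrum ℝ (1 - star z * z), 0 ≤ x := by
    let _ := CStarAlgebra.spectralOrder 𝓜(ℂ, A)
    have _ := CStarAlgebra.spectralOrderedRing 𝓜(ℂ, A)
    have h1 : ‖star z * z‖ ≤ 1 := by
      rw [CStarRing.norm_star_mul_self]
      nlinarith [norm_nonneg z]
    have h2 : star z * z ≤ 1 :=
      (CStarAlgebra.norm_le_one_iff_of_nonneg _ (star_mul_self_nonneg z)).mp h1
    exact fun x hx => spectrum_nonneg_of_nonneg (sub_nonneg.mpr h2) hx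
  unfold defect
  rw [← cfc_mul Real.sqrt Real.sqrt (1 - star z * z)
    Real.continuous_sqrt.continuousOn Real.continuous_sqrt.continuousOn]
  calc cfc (fun x => √x * √x) (1 - star z * z) = cfc (fun x : ℝ => x) (1 - star z * z) :=
        cfc_congr fun x hx => Real.mul_self_sqrt (hspec x hx)
    _ = 1 - star z * z := cfc_id' ℝ _ hsa

theorem eq_zero_of_sum_star_mul {x y : A} (h : star x * x + star y * y = 0) : x = 0 := by
  let _ := CStarAlgebra.spectralOrder A
  have _ := CStarAlgebra.spectralOrderedRing A
  have h1 : star x * x ≤ 0 := by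
    rw [← h]
    exact le_add_of_nonneg_right (star_mul_self_nonneg y)
  exact (CStarRing.star_mul_self_eq_zero_iff x).mp (le_antisymm h1 (star_mul_self_nonneg x))

theorem IsZTransform.unique {T : A →ₗ.[ℂ] A} {z z' : 𝓜(ℂ, A)}
    (h : IsZTransform T z) (h' : IsZTransform T z') : z = z' := by
  have key : ∀ {z : 𝓜(ℂ, A)}, IsZTransform T z → ∀ a t u : A, (t, u) ∈ T.graph →
      star t * (defect z).fst ((defect z).fst a) + star u * z.fst ((defect z).fst a)
        = star t * a := by
    intro z hz a t u htu
    obtain ⟨c, rfl, rfl⟩ := (hz.2 _ _).mp htu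
    rw [star_mul_fst, star_mul_fst, ← mul_add, star_mul_fst, star_defect]
    congr 1
    have e1 : defect z * (defect z * defect z) + star z * (z * defect z) = defect z := by
      rw [← mul_assoc, ← mul_assoc, defect_mul_self hz.1, ← add_mul]
      simp
    exact DFunLike.congr_fun (congrArg (fun m : 𝓜(ℂ, A) => m.fst) e1) a
  have hd : ∀ a, (defect z).fst ((defect z).fst a) = (defect z').fst ((defect z').fst a) := by
    intro a
    have m1 : ((defect z).fst ((defect z).fst a), z.fst ((defect z).fst a)) ∈ T.graph :=
      (h.2 _ _).mpr ⟨_, rfl, rfl⟩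
    have m2 : ((defect z').fst ((defect z').fst a), z'.fst ((defect z').fst a)) ∈ T.graph :=
      (h'.2 _ _).mpr ⟨_, rfl, rfl⟩
    have m := T.graph.sub_mem m1 m2
    have k1 := key h a _ _ m
    have k2 := key h' a _ _ m
    refine sub_eq_zero.mp (eq_zero_of_sum_star_mul
      (y := z.fst ((defect z).fst a) - z'.fst ((defect z').fst a)) ?_)
    have k := sub_eq_zero.mpr (k1.trans k2.symm)
    rw [← k]
    simp only [Prod.fst_sub, Prod.snd_sub, mul_sub]
    abel
  have hdd : defect z * defect z = defect z' * defect z' := multiplier_ext hd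
  rw [defect_mul_self h.1, defect_mul_self h'.1] at hdd
  have hde : defect z = defect z' := by
    unfold defect
    rw [hdd]
  refine multiplier_ext fun a => ?_
  have m1 : ((defect z).fst a, z.fst a) ∈ T.graph := (h.2 _ _).mpr ⟨a, rfl, rfl⟩
  have m2 : ((defect z).fst a, z'.fst a) ∈ T.graph :=
    (h'.2 _ _).mpr ⟨a, by rw [hde], rfl⟩
  exact LinearPMap.mem_graph_snd_inj T m1 m2 rfl

end CStar

end CStarAffiliated

open scoped MultiplierAlgebra

namespace CStarAffiliated

/-! ### Intertwining and square roots in the continuous functional calculus. -/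

section FunctionalCalculus

variable {B : Type*} [CStarAlgebra B]

/-! Write `r`, `s` for the z-transforms of `R`, `S`, and `r'`, `s'` for those of `(q/p)R`, `pqS`.
With `t = q/p` one has `r' = t r k` for a positive invertible `k` commuting with `r`. Since `z(T^*)
= z(T)^*` (`IsZTransform.opAdjoint`), the two relations read `r s^* = s'^* r'` and `r' s = s' r`. As
normality of an operator makes its z-transform normal (`IsZTransform.star_mul_self_eq`), they make
`r` and `r'` intertwine `s^* s` with `s'^* s'`, and `s` intertwine `r^* r` with `r'^* r'`;
functional calculus carries this over to the defects.

Put `D = defect r * defect s`, `D' = defect r' * defect s'` and `c = r k s`. Then `c D = D' c`, and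
`R ∘ S` maps `D a` to `c a`. So the z-transform of the closure should be the contraction `z` with `z
P = c` and `defect z * P = D`, where `P = (D^2 + c^* c)^{1/2}`; `exists_contraction` builds it.
Because `P` has dense range, these pairs `(D a, c a)` are dense in the graph determined by `z`.

Conversely, for `(x, y)` in the graph of `R ∘ S`, the pair `(defect r x, defect r' y)` lies in the
graph of `z`. That graph is the range of a projection commuting with the injective map `(defect r) ⊕
(defect r')`, so `(x, y)` itself lies in it. Hence `R ∘ S` lies between a core and a closed
affiliated operator (`isClosable_and_isAffiliated_closure`). -/

theorem mul_cfc_eq_cfc_mul {x y y' : B} (hy : IsSelfAdjoint y) (hy' : IsSelfAdjoint y')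
    (h : x * y = y' * x) {f : ℝ → ℝ} (hf : Continuous f) :
    x * cfc f y = cfc f y' * x := by
  have hpoly : ∀ P : Polynomial ℝ, x * Polynomial.aeval y P = Polynomial.aeval y' P * x := by
    intro P
    induction P using Polynomial.induction_on with
    | C r => simp only [Polynomial.aeval_C, Algebra.algebraMap_eq_smul_one]; simp
    | add P Q hP hQ => simp only [map_add, mul_add, add_mul, hP, hQ]
    | monomial n r hn =>
      rw [pow_succ, ← mul_assoc, map_mul, map_mul _ (_ * _) Polynomial.X,
        Polynomial.aeval_X, Polynomial.aeval_X, ← mul_assoc, hn, mul_assoc, h, mul_assoc]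
  -- One interval contains both spectra, so a single polynomial approximates `f` on both at once.
  obtain ⟨C, hC⟩ := ((spectrum.isCompact (𝕜 := ℝ) y).union
    (spectrum.isCompact (𝕜 := ℝ) y')).isBounded.subset_closedBall 0
  have hC' : ∀ t, t ∈ spectrum ℝ y ∪ spectrum ℝ y' → t ∈ Set.Icc (-C) C := fun t ht => by
    have := hC ht
    rwa [Metric.mem_closedBall, dist_zero_right, Real.norm_eq_abs, abs_le] at this
  refine sub_eq_zero.mp (norm_le_zero_iff.mp (le_of_forall_pos_le_add fun ε hε => ?_))
  set δ := ε / (2 * (‖x‖ + 1)) with hδ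
  have hx : 0 < ‖x‖ + 1 := by positivity
  have hδ0 : 0 < δ := by positivity
  obtain ⟨P, hP⟩ := exists_polynomial_near_of_continuousOn (-C) C f hf.continuousOn δ hδ0
  have approx : ∀ w : B, IsSelfAdjoint w → (∀ t ∈ spectrum ℝ w, t ∈ Set.Icc (-C) C) →
      ‖cfc f w - Polynomial.aeval w P‖ ≤ δ := by
    intro w hw hs
    rw [← cfc_polynomial P w hw, ← cfc_sub f _ w hf.continuousOn P.continuous.continuousOn]
    refine norm_cfc_le hδ0.le fun t ht => ?_
    rw [norm_sub_rev, Real.norm_eq_abs]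
    exact (hP t (hs t ht)).le
  have e : x * cfc f y - cfc f y' * x = x * (cfc f y - Polynomial.aeval y P)
      - (cfc f y' - Polynomial.aeval y' P) * x := by
    rw [mul_sub, sub_mul, hpoly P]; abel
  rw [e, zero_add]
  calc _ ≤ ‖x‖ * δ + δ * ‖x‖ := (norm_sub_le _ _).trans (add_le_add
          ((norm_mul_le _ _).trans (mul_le_mul_of_nonneg_left
            (approx y hy fun t ht => hC' t (Or.inl ht)) (norm_nonneg _)))
          ((norm_mul_le _ _).trans (mul_le_mul_of_nonneg_right
            (approx y' hy' fun t ht => hC' t (Or.inr ht)) (norm_nonneg _))))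
    _ ≤ 2 * (‖x‖ + 1) * δ := by nlinarith
    _ = ε := by rw [hδ]; field_simp

variable [PartialOrder B] [StarOrderedRing B]

theorem cfc_sqrt_mul_self {a : B} (ha : 0 ≤ a) :
    cfc Real.sqrt a * cfc Real.sqrt a = a := by
  have hsa : IsSelfAdjoint a := .of_nonneg ha
  rw [← cfc_mul Real.sqrt Real.sqrt a
    Real.continuous_sqrt.continuousOn Real.continuous_sqrt.continuousOn]
  calc cfc (fun x => √x * √x) a = cfc (fun x : ℝ => x) a :=
        cfc_congr fun x hx => Real.mul_self_sqrt (spectrum_nonneg_of_nonneg ha hx)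
    _ = a := cfc_id' ℝ _ hsa

theorem cfc_sqrt_of_mul_self {a : B} (ha : 0 ≤ a) : cfc Real.sqrt (a * a) = a := by
  rw [← cfcₙ_eq_cfc (hf0 := Real.sqrt_zero), ← CFC.sqrt_eq_real_sqrt (a * a) ?_, CFC.sqrt_mul_self a ha]
  have := star_mul_self_nonneg a
  rwa [(IsSelfAdjoint.of_nonneg ha).star_eq] at this

theorem cfc_sqrt_nonneg (a : B) : 0 ≤ cfc Real.sqrt a :=
  cfc_nonneg fun x _ => Real.sqrt_nonneg x

theorem star_mul_self_le_one {z : B} (hz : ‖z‖ ≤ 1) : star z * z ≤ 1 := by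
  refine (CStarAlgebra.norm_le_one_iff_of_nonneg _ (star_mul_self_nonneg z)).mp ?_
  rw [CStarRing.norm_star_mul_self]
  nlinarith [norm_nonneg z]

/-- `ε (K + ε)⁻¹ K^{1/2}` has norm at most `ε^{1/2}`. -/
theorem exists_approx_inverse {K : B} (hK : 0 ≤ K) {ε : ℝ} (hε : 0 < ε) :
    ∃ y : B, (∀ x, x * K = K * x → x * y = y * x) ∧ K * y + ε • y = 1 ∧
      ‖ε • (cfc Real.sqrt K * y)‖ ≤ √ε := by
  have hsa : IsSelfAdjoint K := .of_nonneg hK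
  have hs : ∀ x ∈ spectrum ℝ K, 0 ≤ x := fun x hx => spectrum_nonneg_of_nonneg hK hx
  have hc : ContinuousOn (fun x : ℝ => (x + ε)⁻¹) (spectrum ℝ K) :=
    ContinuousOn.inv₀ (by fun_prop) fun x hx => by have := hs x hx; positivity
  refine ⟨cfc (fun x : ℝ => (x + ε)⁻¹) K, fun x hx => ?_, ?_, ?_⟩
  · exact (Commute.cfc_real (show Commute K x from hx.symm) _).symm.eq
  · have h1 : K * cfc (fun x : ℝ => (x + ε)⁻¹) K = cfc (fun x : ℝ => x * (x + ε)⁻¹) K := by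
      rw [cfc_mul (fun x => x) _ K continuousOn_id hc, cfc_id' ℝ K]
    rw [h1, ← cfc_const_mul ε _ K hc, ← cfc_add (a := K) (fun x => x * (x + ε)⁻¹) (fun x => ε * (x + ε)⁻¹)
        (continuousOn_id.mul hc) (continuousOn_const.mul hc),
      ← cfc_one ℝ K]
    refine cfc_congr fun x hx => ?_
    have := hs x hx
    simp only [Pi.one_apply]
    field_simp
  · rw [← cfc_mul _ _ K Real.continuous_sqrt.continuousOn hc,
      ← cfc_const_mul ε (fun x => √x * (x + ε)⁻¹) K (Real.continuous_sqrt.continuousOn.mul hc)]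
    refine norm_cfc_le (Real.sqrt_nonneg _) fun x hx => ?_
    have := hs x hx
    rw [Real.norm_of_nonneg (by positivity)]
    rw [← mul_assoc, mul_inv_le_iff₀ (by positivity)]
    have h1 := Real.mul_self_sqrt this
    have h2 := Real.mul_self_sqrt hε.le
    have h3 := Real.sqrt_nonneg x
    have h4 := Real.sqrt_nonneg ε
    nlinarith [mul_nonneg h4 (sq_nonneg (√x - √ε)), mul_nonneg h4 (mul_nonneg h3 h4)]

end FunctionalCalculus

/-! ### The factor relating the z-transforms of `T` and `lT`. -/

section Scaling

variable {B : Type*} [CStarAlgebra B] [PartialOrder B] [StarOrderedRing B]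

/-- Take `k = (1 + (l² - 1) a)^{-1/2}`; the base is positive because it interpolates between `1` and
`l²` on `[0, 1]`. With `a = z^* z` this turns `z` into `l z k`, the z-transform of `lT`. -/
theorem exists_scaling_factor {a : B} (ha : 0 ≤ a) (ha1 : a ≤ 1) {l : ℝ} (hl : 0 < l) :
    ∃ k : B, 0 ≤ k ∧ (∀ x, Commute a x → Commute k x) ∧ k * k * (1 + (l ^ 2 - 1) • a) = 1 := by
  have hsa : IsSelfAdjoint a := .of_nonneg ha
  have hs : ∀ x ∈ spectrum ℝ a, 0 < 1 + (l ^ 2 - 1) * x := fun x hx => by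
    have h0 : 0 ≤ x := spectrum_nonneg_of_nonneg ha hx
    have h1 : x ≤ 1 := by
      have := (le_algebraMap_iff_spectrum_le (r := (1 : ℝ)) hsa).mp (by simpa using ha1)
      exact this x hx
    have h2 : 0 < l ^ 2 := by positivity
    rcases h1.lt_or_eq with h | rfl
    · nlinarith
    · linarith
  have hc : ContinuousOn (fun x : ℝ => (√(1 + (l ^ 2 - 1) * x))⁻¹) (spectrum ℝ a) :=
    ContinuousOn.inv₀ (by fun_prop) fun x hx => (Real.sqrt_pos.mpr (hs x hx)).ne'
  refine ⟨cfc (fun x : ℝ => (√(1 + (l ^ 2 - 1) * x))⁻¹) a,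
    cfc_nonneg fun x _ => by positivity, fun x hx => hx.cfc_real _, ?_⟩
  have h1 : 1 + (l ^ 2 - 1) • a = cfc (fun x : ℝ => 1 + (l ^ 2 - 1) * x) a := by
    rw [cfc_const_add (1 : ℝ) (fun x => (l ^ 2 - 1) * x) a, cfc_const_mul _ (fun x => x) a,
      cfc_id' ℝ a, map_one]
  rw [h1, ← cfc_mul _ _ a hc hc, 
    ← cfc_mul (fun x => (√(1 + (l ^ 2 - 1) * x))⁻¹ * (√(1 + (l ^ 2 - 1) * x))⁻¹) _ a (hc.mul hc), ← cfc_one ℝ a]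
  refine cfc_congr fun x hx => ?_
  have h2 := Real.mul_self_sqrt (hs x hx).le
  simp only [Pi.one_apply]
  rw [← mul_inv, h2, inv_mul_cancel₀ (hs x hx).ne']

end Scaling

/-! ### The z-transform under adjoints, normality and scaling. -/

section ZTransform

variable {A : Type*} [NonUnitalCStarAlgebra A]

theorem mul_fst_apply (m n : 𝓜(ℂ, A)) (x : A) : (m * n).fst x = m.fst (n.fst x) := rfl

theorem fst_apply_eq_of_mul_eq {m n m' n' : 𝓜(ℂ, A)} (h : m * n = m' * n') (x : A) :
    m.fst (n.fst x) = m'.fst (n'.fst x) := by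
  rw [← mul_fst_apply, h, mul_fst_apply]

theorem IsZTransform.zTransform_eq {T : A →ₗ.[ℂ] A} {z : 𝓜(ℂ, A)} (h : IsZTransform T z) :
    zTransform T = z := by
  have hex : ∃ z : 𝓜(ℂ, A), IsZTransform T z := ⟨z, h⟩
  rw [zTransform, dif_pos hex]
  exact hex.choose_spec.unique h

theorem IsZTransform.denseRange_defect {T : A →ₗ.[ℂ] A} {z : 𝓜(ℂ, A)} (h : IsZTransform T z)
    (hT : Dense (T.domain : Set A)) : DenseRange (defect z).fst := by
  refine hT.mono fun x hx => ?_
  obtain ⟨y, hy⟩ := LinearPMap.mem_domain_iff.mp hx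
  obtain ⟨a, rfl, -⟩ := (h.2 x y).mp hy
  exact ⟨a, rfl⟩

theorem mul_defect_eq {x z z' : 𝓜(ℂ, A)} (h : x * (star z * z) = star z' * z' * x) :
    x * defect z = defect z' * x := by
  refine mul_cfc_eq_cfc_mul ?_ ?_ ?_ Real.continuous_sqrt
  · exact (IsSelfAdjoint.one _).sub (IsSelfAdjoint.star_mul_self z)
  · exact (IsSelfAdjoint.one _).sub (IsSelfAdjoint.star_mul_self z')
  · rw [mul_sub, sub_mul, h, mul_one, one_mul]

theorem mul_defect_self (z : 𝓜(ℂ, A)) : z * defect z = defect (star z) * z :=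
  mul_defect_eq (by rw [star_star, mul_assoc])

theorem star_mul_defect_star (z : 𝓜(ℂ, A)) : star z * defect (star z) = defect z * star z := by
  simpa using mul_defect_self (star z)

theorem defect_fst_defect_fst {z : 𝓜(ℂ, A)} (hz : ‖z‖ ≤ 1) (x : A) :
    (defect z).fst ((defect z).fst x) = x - (star z).fst (z.fst x) := by
  rw [← mul_fst_apply, defect_mul_self hz]; rfl

/-- Testing against the elements `(defect z a, z a)` of the graph of `T` reduces membership of `(y,
w)` in the adjoint graph to `z^* y = defect z w`; the parameter of such a pair is then `defect (z^*)
y + z w`. -/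
theorem IsZTransform.opAdjoint {T : A →ₗ.[ℂ] A} {z : 𝓜(ℂ, A)} (h : IsZTransform T z)
    (hT : Dense (T.domain : Set A)) : IsZTransform (opAdjoint T) (star z) := by
  have hz' : ‖star z‖ ≤ 1 := by rw [norm_star]; exact h.1
  refine ⟨hz', fun y w => ?_⟩
  have h1 : (y, w) ∈ (CStarAffiliated.opAdjoint T).graph ↔ (star z).fst y = (defect z).fst w := by
    rw [graph_opAdjoint T hT]
    constructor
    · intro hyw
      have h2 : ∀ a : A, star a * ((star z).fst y - (defect z).fst w) = 0 := by
        intro a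
        obtain ⟨x, hx1, hx2⟩ := (LinearPMap.mem_graph_iff T).mp ((h.2 _ _).mpr ⟨a, rfl, rfl⟩)
        have h3 := hyw x
        simp only at hx1 hx2 h3
        rw [hx1, hx2, star_mul_fst, star_mul_fst, star_defect] at h3
        rw [mul_sub, h3, sub_self]
      exact sub_eq_zero.mp ((CStarRing.star_mul_self_eq_zero_iff _).mp (h2 _))
    · intro hyw x
      obtain ⟨a, ha1, ha2⟩ := (h.2 _ _).mp (T.mem_graph x)
      rw [ha1, ha2, star_mul_fst, star_mul_fst, star_defect]
      exact congrArg (star a * ·) hyw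
  rw [h1]
  constructor
  · intro hyw
    refine ⟨(defect (star z)).fst y + z.fst w, ?_, ?_⟩
    · rw [map_add, defect_fst_defect_fst hz', star_star, hyw,
        fst_apply_eq_of_mul_eq (mul_defect_self z) w]
      abel
    · rw [map_add, fst_apply_eq_of_mul_eq (star_mul_defect_star z) y, hyw,
        defect_fst_defect_fst h.1]
      abel
  · rintro ⟨b, rfl, rfl⟩
    exact fst_apply_eq_of_mul_eq (star_mul_defect_star z) b

/-- The operator `T^* T` maps `(1 - z^* z) a` to `z^* z a`, and `T T^*` maps `(1 - z z^*) a` to `z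
z^* a`. If the two operators agree, the difference `ξ` of the arguments satisfies `T T^* ξ = -ξ`,
and positivity of `T T^*` forces `ξ = 0`. -/
theorem IsZTransform.star_mul_self_eq {T : A →ₗ.[ℂ] A} {z : 𝓜(ℂ, A)} (h : IsZTransform T z)
    (hT : Dense (T.domain : Set A)) (hn : IsNormalOp T) : star z * z = z * star z := by
  have h' := h.opAdjoint hT
  have m1 : ∀ {z : 𝓜(ℂ, A)} {T T' : A →ₗ.[ℂ] A}, IsZTransform T z → IsZTransform T' (star z) →
      ∀ a, (a - (star z).fst (z.fst a), (star z).fst (z.fst a)) ∈ (opComp T' T).graph := by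
    intro z T T' h h' a
    refine (mem_graph_opComp _ _ _ _).mpr ⟨z.fst ((defect z).fst a), ?_, ?_⟩
    · exact (h.2 _ _).mpr ⟨(defect z).fst a, (defect_fst_defect_fst h.1 a).symm, rfl⟩
    · exact (h'.2 _ _).mpr ⟨z.fst a, fst_apply_eq_of_mul_eq (mul_defect_self z) a, rfl⟩
  refine multiplier_ext fun a => ?_
  have k1 := m1 h h' a
  rw [hn] at k1
  have k2 := m1 h' (by rwa [star_star]) a
  rw [star_star] at k2
  obtain ⟨w, hw1, hw2⟩ := (mem_graph_opComp _ _ _ _).mp (Submodule.sub_mem _ k1 k2)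
  rw [graph_opAdjoint T hT] at hw1
  obtain ⟨x, hx1, hx2⟩ := (LinearPMap.mem_graph_iff T).mp hw2
  have h3 := hw1 x
  simp only at hx1 hx2 h3
  rw [hx1, hx2] at h3
  have h4 := eq_zero_of_sum_star_mul (x := (a - (star z).fst (z.fst a)) - (a - z.fst ((star z).fst a)))
    (y := w) (by
      rw [← h3, ← add_mul, ← star_add]
      convert zero_mul _ using 2
      rw [star_eq_zero]; abel)
  rw [sub_sub_sub_cancel_left, sub_eq_zero] at h4
  exact h4.symm

theorem mem_graph_smul_iff {T : A →ₗ.[ℂ] A} {l : ℂ} {x y : A} :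
    (x, y) ∈ (l • T).graph ↔ ∃ w, (x, w) ∈ T.graph ∧ y = l • w := by
  rw [LinearPMap.smul_graph, Submodule.mem_map]
  constructor
  · rintro ⟨⟨a, b⟩, hab, hxy⟩
    simp only [LinearMap.prodMap_apply, LinearMap.id_apply, LinearMap.smul_apply,
      Prod.mk.injEq] at hxy
    obtain ⟨rfl, rfl⟩ := hxy
    exact ⟨b, hab, rfl⟩
  · rintro ⟨w, hw, rfl⟩
    exact ⟨(x, w), hw, rfl⟩

theorem IsZTransform.smul [PartialOrder 𝓜(ℂ, A)] [StarOrderedRing 𝓜(ℂ, A)]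
    {T : A →ₗ.[ℂ] A} {z : 𝓜(ℂ, A)} (h : IsZTransform T z) {l : ℝ} (hl : 0 < l) :
    ∃ k : 𝓜(ℂ, A), IsSelfAdjoint k ∧ (∀ x, Commute (star z * z) x → Commute k x) ∧
      defect ((l : ℂ) • (z * k)) = defect z * k ∧
      IsZTransform ((l : ℂ) • T) ((l : ℂ) • (z * k)) := by
  obtain ⟨k, hk0, hkc, hk1⟩ := exists_scaling_factor (star_mul_self_nonneg z)
    (star_mul_self_le_one h.1) hl
  have hk : IsSelfAdjoint k := .of_nonneg hk0
  have hka : k * (star z * z) = star z * z * k := hkc _ (Commute.refl _)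
  have hkd : Commute k (defect z) := (mul_defect_eq hka)
  have hd0 : 0 ≤ defect z := cfc_sqrt_nonneg _
  have e1 : star ((l : ℂ) • (z * k)) * ((l : ℂ) • (z * k)) = (l ^ 2) • (k * k * (star z * z)) := by
    have : star ((l : ℂ) • (z * k)) = (l : ℂ) • (k * star z) := by
      rw [star_smul, star_mul, hk.star_eq]; simp
    rw [this, smul_mul_smul_comm, mul_assoc k k, hka]
    simp only [← mul_assoc]
    rw [← Complex.coe_smul, sq, Complex.ofReal_mul]
  have e2 : (defect z * k) * (defect z * k) =
      1 - star ((l : ℂ) • (z * k)) * ((l : ℂ) • (z * k)) := by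
    calc (defect z * k) * (defect z * k) = k * k * (defect z * defect z) := by
          rw [← hkd.eq, mul_assoc k (defect z), ← mul_assoc (defect z) k, ← hkd.eq]
          simp only [mul_assoc]
      _ = k * k * (1 + (l ^ 2 - 1) • (star z * z)) - l ^ 2 • (k * k * (star z * z)) := by
          rw [defect_mul_self h.1, mul_add, mul_sub, mul_smul_comm, sub_smul, one_smul]
          abel
      _ = _ := by rw [hk1, e1]
  have e3 : defect ((l : ℂ) • (z * k)) = defect z * k := by
    rw [defect, ← e2, cfc_sqrt_of_mul_self (Commute.mul_nonneg hd0 hk0 hkd.symm)]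
  refine ⟨k, hk, hkc, e3, ?_, fun x y => ?_⟩
  · have h1 : star ((l : ℂ) • (z * k)) * ((l : ℂ) • (z * k)) ≤ 1 := by
      rw [← sub_nonneg, ← e2]
      have := star_mul_self_nonneg (defect z * k)
      rwa [star_mul, star_defect, hk.star_eq, hkd.eq] at this
    have h2 := (CStarAlgebra.norm_le_one_iff_of_nonneg _ (star_mul_self_nonneg _)).mpr h1
    rw [CStarRing.norm_star_mul_self] at h2
    nlinarith [norm_nonneg ((l : ℂ) • (z * k))]
  · rw [e3, mem_graph_smul_iff]
    constructor
    · rintro ⟨w, hw, rfl⟩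
      obtain ⟨a, rfl, rfl⟩ := (h.2 _ _).mp hw
      -- This `g` is a right inverse of `k`, so passing from `a` to `g a` absorbs the factor `k`.
      set g : 𝓜(ℂ, A) := k * (1 + (l ^ 2 - 1) • (star z * z))
      have hg : ∀ m : 𝓜(ℂ, A), m.fst a = (m * k).fst (g.fst a) := fun m => by
        rw [← mul_fst_apply, mul_assoc, ← mul_assoc k, hk1, mul_one]
      exact ⟨g.fst a, hg _, congrArg _ (hg z)⟩
    · rintro ⟨a, rfl, rfl⟩
      exact ⟨_, (h.2 _ _).mpr ⟨k.fst a, rfl, rfl⟩, rfl⟩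

end ZTransform

/-! ### Construction of a contraction from a numerator and a denominator. -/

section Polar

variable {A : Type*} [NonUnitalCStarAlgebra A]

/-- An adjointable map is left multiplication by a multiplier; the matching right multiplication is
`x ↦ (L' x^*)^*`. -/
theorem exists_multiplier_of_adjoint {L L' : A →L[ℂ] A}
    (h : ∀ x y, star (L x) * y = star x * L' y) :
    ∃ m : 𝓜(ℂ, A), m.fst = L ∧ (star m).fst = L' := by
  let N : A →L[ℂ] A :=
    { toFun := fun x => star (L' (star x))
      map_add' := fun x y => by simp
      map_smul' := fun r x => by simp
      cont := continuous_star.comp (L'.continuous.comp continuous_star) }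
  refine ⟨⟨(L, N), fun x y => ?_⟩, rfl, ?_⟩
  · have := congrArg star (h y (star x))
    simp only [star_mul, star_star] at this
    exact this.symm
  · ext b
    rw [DoubleCentralizer.star_fst]
    change star (star (L' (star (star b)))) = L' b
    simp

theorem norm_fst_le_of_star_mul_self_eq {p m n : 𝓜(ℂ, A)}
    (h : star p * p = star m * m + star n * n) (x : A) : ‖m.fst x‖ ≤ ‖p.fst x‖ := by
  let _ := CStarAlgebra.spectralOrder A
  have _ := CStarAlgebra.spectralOrderedRing A
  have e : ∀ q : 𝓜(ℂ, A), star (q.fst x) * q.fst x = star x * (star q * q).fst x :=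
    fun q => star_mul_fst q _ _
  have h1 : star (p.fst x) * p.fst x = star (m.fst x) * m.fst x + star (n.fst x) * n.fst x := by
    rw [e, e, e, h, ← mul_add]; rfl
  have h2 : ‖star (m.fst x) * m.fst x‖ ≤ ‖star (p.fst x) * p.fst x‖ := by
    refine CStarAlgebra.norm_le_norm_of_nonneg_of_le (star_mul_self_nonneg _) ?_
    rw [h1]
    exact le_add_of_nonneg_right (star_mul_self_nonneg _)
  rw [CStarRing.norm_star_mul_self, CStarRing.norm_star_mul_self] at h2
  exact (mul_self_le_mul_self_iff (norm_nonneg _) (norm_nonneg _)).mpr h2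

theorem multiplier_eq_of_mul_eq {m n P : 𝓜(ℂ, A)} (hP : DenseRange P.fst) (h : m * P = n * P) :
    m = n := by
  refine multiplier_ext fun a => congrFun (hP.equalizer m.fst.continuous n.fst.continuous ?_) a
  exact funext fun x => fst_apply_eq_of_mul_eq h x

variable [PartialOrder 𝓜(ℂ, A)] [StarOrderedRing 𝓜(ℂ, A)]

theorem sqrt_star_mul_self_eq (K : 𝓜(ℂ, A)) (hK : 0 ≤ K) :
    star (cfc Real.sqrt K) * cfc Real.sqrt K = K := by
  rw [(IsSelfAdjoint.cfc : IsSelfAdjoint (cfc Real.sqrt K)).star_eq, cfc_sqrt_mul_self hK]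

/-- With `y = (K + δ)⁻¹` and `P = K^{1/2}`, the error `D - P (P y D)` equals `δ D y`. Domination of
`D` by `P` bounds it by `‖δ P y‖ ≤ √δ`, so the range of `D` lies in the closure of that of `P`. -/
theorem denseRange_sqrt {D n K : 𝓜(ℂ, A)} (hD : DenseRange D.fst)
    (hK : K = star D * D + star n * n) (hDK : D * K = K * D) :
    DenseRange (cfc Real.sqrt K).fst := by
  have hK0 : 0 ≤ K := hK ▸ add_nonneg (star_mul_self_nonneg _) (star_mul_self_nonneg _)
  set P := cfc Real.sqrt K
  have hPP : P * P = K := cfc_sqrt_mul_self hK0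
  have hle : ∀ x, ‖D.fst x‖ ≤ ‖P.fst x‖ := fun x =>
    norm_fst_le_of_star_mul_self_eq ((sqrt_star_mul_self_eq K hK0).trans hK) x
  have hsub : Set.range D.fst ⊆ closure (Set.range P.fst) := by
    rintro _ ⟨x, rfl⟩
    refine Metric.mem_closure_iff.mpr fun ε hε => ?_
    obtain ⟨δ, hδ, hδε⟩ : ∃ δ > 0, √δ * ‖x‖ < ε := by
      refine ⟨(ε / (‖x‖ + 1)) ^ 2, by positivity, ?_⟩
      rw [Real.sqrt_sq (by positivity), div_mul_eq_mul_div, div_lt_iff₀ (by positivity)]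
      nlinarith [norm_nonneg x]
    obtain ⟨y, hy1, hy2, hy3⟩ := exists_approx_inverse hK0 hδ
    refine ⟨P.fst ((P * y * D).fst x), ⟨_, rfl⟩, lt_of_le_of_lt ?_ hδε⟩
    have hyD : D * y = y * D := hy1 D hDK
    have e : D - P * (P * y * D) = δ • (D * y) := by
      rw [← mul_assoc P, ← mul_assoc P, hPP, hyD]
      calc D - K * y * D = (K * y + δ • y) * D - K * y * D := by rw [hy2, one_mul]
        _ = δ • (y * D) := by rw [add_mul, add_sub_cancel_left, smul_mul_assoc]
    rw [dist_eq_norm]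
    calc ‖D.fst x - P.fst ((P * y * D).fst x)‖ = ‖(D - P * (P * y * D)).fst x‖ := rfl
      _ = ‖D.fst ((δ • y).fst x)‖ := by rw [e, ← mul_smul_comm]; rfl
      _ ≤ ‖P.fst ((δ • y).fst x)‖ := hle _
      _ = ‖(δ • (P * y)).fst x‖ := by rw [← mul_fst_apply, mul_smul_comm]
      _ ≤ ‖δ • (P * y)‖ * ‖x‖ := by
          rw [← DoubleCentralizer.norm_fst]; exact ContinuousLinearMap.le_opNorm _ _
      _ ≤ √δ * ‖x‖ := mul_le_mul_of_nonneg_right hy3 (norm_nonneg _)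
  exact dense_iff_closure_eq.mpr (Set.eq_univ_of_univ_subset
    (hD.closure_range ▸ closure_minimal hsub isClosed_closure))

/-- The contraction `z` with `z (D² + c^* c)^{1/2} = c`. -/
theorem exists_contraction {c D D' : 𝓜(ℂ, A)} (hD : 0 ≤ D) (hD' : IsSelfAdjoint D')
    (hDd : DenseRange D.fst) (hDd' : DenseRange D'.fst) (h : c * D = D' * c) :
    ∃ z P : 𝓜(ℂ, A), ‖z‖ ≤ 1 ∧ DenseRange P.fst ∧ z * P = c ∧ defect z * P = D ∧
      ∀ F F' : 𝓜(ℂ, A), IsSelfAdjoint F → IsSelfAdjoint F' → c * F = F' * c → F * D = D * F →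
        z * F = F' * z ∧ F * defect z = defect z * F := by
  have hDs : star D = D := (IsSelfAdjoint.of_nonneg hD).star_eq
  have hDs' : star D' = D' := hD'.star_eq
  have h' : D * star c = star c * D' := by simpa [hDs, hDs'] using congrArg star h
  have hDc : D * (star c * c) = star c * c * D := by
    rw [← mul_assoc, h', mul_assoc, ← h, mul_assoc]
  have hDc' : D' * (c * star c) = c * star c * D' := by
    rw [← mul_assoc, ← h, mul_assoc, h', mul_assoc]
  obtain ⟨K, hK⟩ : ∃ K, K = star D * D + star c * c := ⟨_, rfl⟩
  obtain ⟨K', hK'⟩ : ∃ K', K' = star D' * D' + star (star c) * star c := ⟨_, rfl⟩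
  have hK0 : 0 ≤ K := hK ▸ add_nonneg (star_mul_self_nonneg _) (star_mul_self_nonneg _)
  have hK0' : 0 ≤ K' := hK' ▸ add_nonneg (star_mul_self_nonneg _) (star_mul_self_nonneg _)
  obtain ⟨P, hPdef⟩ : ∃ P, P = cfc Real.sqrt K := ⟨_, rfl⟩
  obtain ⟨P', hPdef'⟩ : ∃ P', P' = cfc Real.sqrt K' := ⟨_, rfl⟩
  have hP0 : 0 ≤ P := hPdef ▸ cfc_sqrt_nonneg K
  have hPs : star P = P := (IsSelfAdjoint.of_nonneg hP0).star_eq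
  have hPP : P * P = K := hPdef ▸ cfc_sqrt_mul_self hK0
  have hPs' : star P' = P' := hPdef' ▸ (IsSelfAdjoint.of_nonneg (cfc_sqrt_nonneg K')).star_eq
  have hDK : D * K = K * D := by
    rw [hK, mul_add, add_mul, hDc, hDs, mul_assoc D]
  have hDK' : D' * K' = K' * D' := by
    rw [hK', mul_add, add_mul, star_star, hDc', hDs', mul_assoc D']
  have hPd : DenseRange P.fst := hPdef ▸ denseRange_sqrt hDd hK hDK
  have hPd' : DenseRange P'.fst := hPdef' ▸ denseRange_sqrt hDd' hK' hDK'
  have hcK : c * K = K' * c := by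
    rw [hK, hK', mul_add, add_mul, hDs, hDs', star_star, ← mul_assoc, h, mul_assoc, h,
      ← mul_assoc, ← mul_assoc]
  -- The partner `P'` is what makes the extension adjointable: the candidate adjoint sends `P' b` to
  -- `c^* b`.
  have hcP : c * P = P' * c := by
    rw [hPdef, hPdef']
    exact mul_cfc_eq_cfc_mul (.of_nonneg hK0) (.of_nonneg hK0') hcK Real.continuous_sqrt
  have hcP' : P * star c = star c * P' := by simpa [hPs, hPs'] using congrArg star hcP
  have hle : ∀ x, ‖c.fst x‖ ≤ 1 * ‖P.fst x‖ := fun x => by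
    rw [one_mul, hPdef]
    exact norm_fst_le_of_star_mul_self_eq
      ((sqrt_star_mul_self_eq K hK0).trans (hK.trans (add_comm _ _))) x
  have hle' : ∀ x, ‖(star c).fst x‖ ≤ 1 * ‖P'.fst x‖ := fun x => by
    rw [one_mul, hPdef']
    exact norm_fst_le_of_star_mul_self_eq
      ((sqrt_star_mul_self_eq K' hK0').trans (hK'.trans (add_comm _ _))) x
  obtain ⟨L, hL, hL1⟩ : ∃ L : A →L[ℂ] A, (∀ x, L (P.fst x) = c.fst x) ∧ ‖L‖ ≤ 1 :=
    ⟨(c.fst : A →ₗ[ℂ] A).extendOfNorm (P.fst : A →ₗ[ℂ] A),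
      LinearMap.extendOfNorm_eq (f := (c.fst : A →ₗ[ℂ] A)) (e := (P.fst : A →ₗ[ℂ] A)) hPd ⟨1, hle⟩,
      LinearMap.opNorm_extendOfNorm_le hPd zero_le_one hle⟩
  obtain ⟨L', hL'⟩ : ∃ L' : A →L[ℂ] A, ∀ x, L' (P'.fst x) = (star c).fst x :=
    ⟨((star c).fst : A →ₗ[ℂ] A).extendOfNorm (P'.fst : A →ₗ[ℂ] A),
      LinearMap.extendOfNorm_eq (f := ((star c).fst : A →ₗ[ℂ] A)) (e := (P'.fst : A →ₗ[ℂ] A)) hPd'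
        ⟨1, hle'⟩⟩
  have hadj : ∀ x y, star (L x) * y = star x * L' y := by
    intro x y
    refine hPd.induction_on (p := fun x => star (L x) * y = star x * L' y) x
      (isClosed_eq (by fun_prop) (by fun_prop)) fun a => ?_
    refine hPd'.induction_on (p := fun y => star (L (P.fst a)) * y = star (P.fst a) * L' y) y
      (isClosed_eq (by fun_prop) (by fun_prop)) fun b => ?_
    rw [hL, hL', star_mul_fst, star_mul_fst, hPs, fst_apply_eq_of_mul_eq hcP']
  obtain ⟨z, hz, -⟩ := exists_multiplier_of_adjoint hadj
  have hzP : z * P = c := multiplier_ext fun a => by rw [mul_fst_apply, hz, hL]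
  have hz1 : ‖z‖ ≤ 1 := by rw [← DoubleCentralizer.norm_fst, hz]; exact hL1
  have key : ∀ F F' : 𝓜(ℂ, A), IsSelfAdjoint F → IsSelfAdjoint F' → c * F = F' * c →
      F * P = P * F → z * F = F' * z ∧ F * defect z = defect z * F := by
    intro F F' hF hF' hcF hFP
    have h1 : z * F = F' * z := by
      refine multiplier_eq_of_mul_eq hPd ?_
      rw [mul_assoc, hFP, ← mul_assoc, hzP, hcF, mul_assoc, hzP]
    have h2 : F * star z = star z * F' := by
      simpa [hF.star_eq, hF'.star_eq] using congrArg star h1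
    exact ⟨h1, mul_defect_eq (by rw [← mul_assoc, h2, mul_assoc, ← h1, mul_assoc])⟩
  -- Here `P` itself plays the role of `F`. Once it commutes with `defect z`, the product `defect z
  -- * P` is positive, so comparing its square with `D²` suffices.
  obtain ⟨-, hPe⟩ := key P P' hPs hPs' hcP rfl
  have heP0 : 0 ≤ defect z * P := Commute.mul_nonneg (cfc_sqrt_nonneg _) hP0 hPe.symm
  have heP : defect z * P = D := by
    rw [← cfc_sqrt_of_mul_self heP0, ← cfc_sqrt_of_mul_self hD]
    congr 1
    calc defect z * P * (defect z * P) = P * defect z * (defect z * P) := by rw [hPe]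
      _ = P * (defect z * defect z) * P := by simp only [mul_assoc]
      _ = P * P - star (z * P) * (z * P) := by
          rw [defect_mul_self hz1, star_mul, hPs]; noncomm_ring
      _ = D * D := by rw [hzP, hPP, hK, hDs, add_sub_cancel_right]
  refine ⟨z, P, hz1, hPd, hzP, heP, fun F F' hF hF' hcF hFD => key F F' hF hF' hcF ?_⟩
  have h2 : F * star c = star c * F' := by
    simpa [hF.star_eq, hF'.star_eq] using congrArg star hcF
  have hFK : F * K = K * F := by
    rw [hK, mul_add, add_mul, hDs, ← mul_assoc, hFD, mul_assoc, hFD, ← mul_assoc F, h2, mul_assoc,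
      ← hcF, mul_assoc, mul_assoc]
  rw [hPdef]
  exact (Commute.cfc_real (show Commute K F from hFK.symm) _).symm.eq

end Polar

/-! ### Graphs of contractions and the closure of the product. -/

section Closure

variable {A : Type*} [NonUnitalCStarAlgebra A]

theorem eq_zero_of_fst_eq_zero {d : 𝓜(ℂ, A)} (hd : IsSelfAdjoint d) (hdd : DenseRange d.fst)
    {a : A} (h : d.fst a = 0) : a = 0 := by
  have h1 : ∀ x, star x * a = 0 := fun x =>
    hdd.induction_on (p := fun x => star x * a = 0) x
      (isClosed_eq (by fun_prop) continuous_const) fun b => by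
        rw [star_mul_fst, hd.star_eq, h, mul_zero]
  exact (CStarRing.star_mul_self_eq_zero_iff a).mp (h1 a)

theorem defect_fst_add_star_fst {z : 𝓜(ℂ, A)} (hz : ‖z‖ ≤ 1) (a : A) :
    (defect z).fst ((defect z).fst a) + (star z).fst (z.fst a) = a := by
  rw [defect_fst_defect_fst hz, sub_add_cancel]

/-- The map `V a = (defect z a, z a)` satisfies `V^* V = 1`, so its range is the fixed space of the
projection `V V^*`. This gives closedness of the graph and a membership test that can be checked
after applying injective maps. -/
theorem exists_fst_eq_iff {z : 𝓜(ℂ, A)} (hz : ‖z‖ ≤ 1) (x y : A) :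
    (∃ a, x = (defect z).fst a ∧ y = z.fst a) ↔
      x = (defect z).fst ((defect z).fst x + (star z).fst y) ∧
        y = z.fst ((defect z).fst x + (star z).fst y) := by
  refine ⟨?_, fun h => ⟨_, h.1, h.2⟩⟩
  rintro ⟨a, rfl, rfl⟩
  rw [defect_fst_add_star_fst hz]
  exact ⟨rfl, rfl⟩

/-- Density of the range of `defect z` makes `defect z` injective, so the closed space determined by
`z` is the graph of an operator. Density of the range of `P` makes `hsup` produce a dense part of
that graph. -/
theorem isClosable_and_isAffiliated_closure {T : A →ₗ.[ℂ] A} {z P : 𝓜(ℂ, A)} (hz : ‖z‖ ≤ 1)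
    (hd : DenseRange (defect z).fst) (hP : DenseRange P.fst)
    (hsub : ∀ x y, (x, y) ∈ T.graph → ∃ a, x = (defect z).fst a ∧ y = z.fst a)
    (hsup : ∀ a, ((defect z).fst (P.fst a), z.fst (P.fst a)) ∈ T.graph) :
    T.IsClosable ∧ IsAffiliated T.closure := by
  let G : Submodule ℂ (A × A) :=
    LinearMap.range (((defect z).fst : A →ₗ[ℂ] A).prod (z.fst : A →ₗ[ℂ] A))
  have hG : ∀ x y, (x, y) ∈ G ↔ ∃ a, x = (defect z).fst a ∧ y = z.fst a := by
    intro x y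
    constructor
    · rintro ⟨a, ha⟩
      exact ⟨a, (congrArg Prod.fst ha).symm, (congrArg Prod.snd ha).symm⟩
    · rintro ⟨a, rfl, rfl⟩
      exact ⟨a, rfl⟩
  have hGcl : IsClosed (G : Set (A × A)) := by
    have : (G : Set (A × A)) = {p | p.1 = (defect z).fst ((defect z).fst p.1 + (star z).fst p.2)} ∩
        {p | p.2 = z.fst ((defect z).fst p.1 + (star z).fst p.2)} := by
      ext ⟨x, y⟩
      exact (hG x y).trans (exists_fst_eq_iff hz x y)
    rw [this]
    exact (isClosed_eq (by fun_prop) (by fun_prop)).inter (isClosed_eq (by fun_prop) (by fun_prop))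
  have hGg : G.toLinearPMap.graph = G := by
    refine Submodule.toLinearPMap_graph_eq G ?_
    rintro ⟨x, y⟩ hxy (rfl : x = 0)
    obtain ⟨a, ha, rfl⟩ := (hG _ _).mp hxy
    change z.fst a = 0
    rw [eq_zero_of_fst_eq_zero (star_defect z) hd ha.symm, map_zero]
  have hle : T.graph ≤ G := by
    rintro ⟨x, y⟩ hxy
    exact (hG x y).mpr (hsub x y hxy)
  have hcl : T.IsClosable := LinearPMap.isClosable_iff_exists_closed_extension.mpr
    ⟨G.toLinearPMap, by rwa [LinearPMap.IsClosed, hGg],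
      LinearPMap.le_of_le_graph (by rwa [hGg])⟩
  have hgr : T.closure.graph = G := by
    rw [← hcl.graph_closure_eq_closure_graph]
    refine le_antisymm (Submodule.topologicalClosure_minimal _ hle hGcl) ?_
    rintro _ ⟨a, rfl⟩
    refine hP.induction_on (p := fun a => ((defect z).fst a, z.fst a) ∈ T.graph.topologicalClosure) a
      (T.graph.isClosed_topologicalClosure.preimage (by fun_prop)) fun b =>
      T.graph.le_topologicalClosure (hsup b)
  have hzt : IsZTransform T.closure z := ⟨hz, fun x y => by rw [hgr, hG]⟩
  refine ⟨hcl, hd.mono ?_, z, hzt⟩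
  rintro _ ⟨a, rfl⟩
  exact LinearPMap.mem_domain_of_mem_graph ((hzt.2 _ _).mpr ⟨a, rfl, rfl⟩)

theorem opAdjoint_smul {T : A →ₗ.[ℂ] A} (hT : Dense (T.domain : Set A)) {l : ℝ} (hl : l ≠ 0) :
    opAdjoint ((l : ℂ) • T) = (l : ℂ) • opAdjoint T := by
  have hl' : (l : ℂ) ≠ 0 := by exact_mod_cast hl
  refine LinearPMap.eq_of_eq_graph (Submodule.ext fun ⟨y, w⟩ => ?_)
  have e : ∀ x : T.domain, star (((l : ℂ) • T) x) * y = (l : ℂ) • (star (T x) * y) := fun x => by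
    rw [LinearPMap.smul_apply, star_smul, smul_mul_assoc]; simp
  rw [graph_opAdjoint _ (by exact hT), mem_graph_smul_iff, graph_opAdjoint T hT]
  constructor
  · refine fun h => ⟨(l : ℂ)⁻¹ • w, fun x => ?_, by rw [smul_inv_smul₀ hl']⟩
    have h1 := h x
    simp only at h1 ⊢
    rw [mul_smul_comm, ← h1, e, inv_smul_smul₀ hl']
  · rintro ⟨v, hv, rfl⟩ x
    have h1 := hv x
    simp only at h1 ⊢
    rw [mul_smul_comm, ← h1, e]

variable [PartialOrder 𝓜(ℂ, A)] [StarOrderedRing 𝓜(ℂ, A)]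

theorem isClosable_opComp_and_isAffiliated_closure {R S : A →ₗ.[ℂ] A} {r s r' s' k : 𝓜(ℂ, A)}
    {t : ℝ} (ht : 0 < t) (hR : IsZTransform R r) (hS : IsZTransform S s)
    (hr : star r * r = r * star r) (hs : star s * s = s * star s)
    (hr' : star r' * r' = r' * star r') (hs' : star s' * s' = s' * star s')
    (hk : r' = (t : ℂ) • (r * k)) (hkr : Commute k r) (hkd : Commute k (defect r))
    (hdk : defect r' = defect r * k)
    (hdr : DenseRange (defect r).fst) (hds : DenseRange (defect s).fst)
    (hdr' : DenseRange (defect r').fst) (hds' : DenseRange (defect s').fst)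
    (h1 : r * star s = star s' * r') (h2 : r' * s = s' * r) :
    (opComp R S).IsClosable ∧ IsAffiliated (opComp R S).closure := by
  have ht' : (t : ℂ) ≠ 0 := by exact_mod_cast ht.ne'
  -- intertwining relations with the squared moduli
  have rb : r * (star s * s) = star s' * s' * r := by rw [← mul_assoc, h1, mul_assoc, h2, mul_assoc]
  have rb' : r' * (star s * s) = star s' * s' * r' := by
    rw [hs, ← mul_assoc, h2, mul_assoc, h1, ← mul_assoc, hs']
  have h1s : s * star r = star r' * s' := by simpa using congrArg star h1
  have h2s : star s * star r' = star r * star s' := by simpa using congrArg star h2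
  have rbs : star r * (star s' * s') = star s * s * star r := by
    simpa [mul_assoc] using (congrArg star rb).symm
  have rbs' : star r' * (star s' * s') = star s * s * star r' := by
    simpa [mul_assoc] using (congrArg star rb').symm
  have ab : star r * r * (star s * s) = star s * s * (star r * r) := by
    rw [mul_assoc, rb, ← mul_assoc, rbs, mul_assoc]
  have ab' : star r' * r' * (star s' * s') = star s' * s' * (star r' * r') := by
    rw [hr', mul_assoc, rbs', ← mul_assoc, rb', mul_assoc]
  have sa : s * (star r * r) = star r' * r' * s := by
    rw [← mul_assoc, h1s, mul_assoc, ← h2, mul_assoc]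
  -- the same with the defects
  have rds' : r' * defect s = defect s' * r' := mul_defect_eq rb'
  have sdr : s * defect r = defect r' * s := mul_defect_eq sa
  have dd : Commute (defect r) (defect s) := mul_defect_eq (mul_defect_eq ab.symm).symm
  have dd' : Commute (defect r') (defect s') := mul_defect_eq (mul_defect_eq ab'.symm).symm
  have rdr : r * defect r = defect r * r := mul_defect_eq (by rw [← mul_assoc, ← hr, mul_assoc])
  have rdr' : r' * defect r' = defect r' * r' :=
    mul_defect_eq (by rw [← mul_assoc, ← hr', mul_assoc])
  have sds : s * defect s = defect s * s := mul_defect_eq (by rw [← mul_assoc, ← hs, mul_assoc])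
  obtain ⟨c, hc⟩ : ∃ c, c = (t : ℂ)⁻¹ • (r' * s) := ⟨_, rfl⟩
  have hcs : c = r * k * s := by
    rw [hc, hk, smul_mul_assoc, smul_smul, inv_mul_cancel₀ ht', one_smul]
  have cdr : c * defect r = defect r' * c := by
    rw [hc, smul_mul_assoc, mul_assoc, sdr, ← mul_assoc, rdr', mul_assoc, mul_smul_comm]
  have cds : c * defect s = defect s' * c := by
    rw [hc, smul_mul_assoc, mul_assoc, sds, ← mul_assoc, rds', mul_assoc, mul_smul_comm]
  obtain ⟨z, P, hz, hP, hzP, heP, hF⟩ := exists_contraction (c := c)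
    (D := defect r * defect s) (D' := defect r' * defect s')
    (Commute.mul_nonneg (cfc_sqrt_nonneg _) (cfc_sqrt_nonneg _) dd)
    (IsSelfAdjoint.commute_iff (star_defect r') (star_defect s') |>.mp dd')
    (hdr.comp hds (defect r).fst.continuous) (hdr'.comp hds' (defect r').fst.continuous)
    (by rw [← mul_assoc, cdr, mul_assoc, cds, mul_assoc])
  -- These relations say that `(defect r) ⊕ (defect r')` commutes with the projection onto the graph
  -- of `z`.
  obtain ⟨zF, Fe⟩ := hF (defect r) (defect r') (star_defect r) (star_defect r') cdr
    (by rw [mul_assoc, dd.eq])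
  have zF' : defect r * star z = star z * defect r' := by
    simpa [star_defect] using congrArg star zF
  have hde : DenseRange (defect z).fst := by
    refine (hdr.comp hds (defect r).fst.continuous).mono ?_
    rintro _ ⟨a, rfl⟩
    exact ⟨P.fst a, fst_apply_eq_of_mul_eq heP a⟩
  refine isClosable_and_isAffiliated_closure hz hde hP (fun x y hxy => ?_) fun a => ?_
  · obtain ⟨w, hxw, hwy⟩ := (mem_graph_opComp _ _ _ _).mp hxy
    obtain ⟨u, rfl, hu⟩ := (hS.2 _ _).mp hxw
    obtain ⟨v, hv, rfl⟩ := (hR.2 _ _).mp hwy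
    have hx : (defect r).fst ((defect s).fst u) = (defect z).fst (P.fst u) :=
      fst_apply_eq_of_mul_eq heP.symm u
    have hy : (defect r').fst (r.fst v) = z.fst (P.fst u) := by
      have e1 : r * k * defect r = defect r' * r := by
        rw [mul_assoc, hkd.eq, ← hdk, hdk, ← mul_assoc, rdr, mul_assoc, mul_assoc, hkr.eq]
      rw [← fst_apply_eq_of_mul_eq e1, ← hv, hu, ← mul_fst_apply z, hzP, hcs]
      rfl
    set x := (defect s).fst u
    set y := r.fst v
    -- By `hx` and `hy` the smoothed pair is `(defect z, z)` applied to `P u`; the injective defects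
    -- are cancelled afterwards.
    have hrec : (defect r).fst ((defect z).fst x + (star z).fst y) = P.fst u := by
      rw [map_add, fst_apply_eq_of_mul_eq Fe, fst_apply_eq_of_mul_eq zF', hx, hy,
        defect_fst_add_star_fst hz]
    refine (exists_fst_eq_iff hz x y).mpr ⟨?_, ?_⟩
    · refine sub_eq_zero.mp (eq_zero_of_fst_eq_zero (star_defect r) hdr ?_)
      rw [map_sub, fst_apply_eq_of_mul_eq Fe, hrec, hx, sub_self]
    · refine sub_eq_zero.mp (eq_zero_of_fst_eq_zero (star_defect r') hdr' ?_)
      rw [map_sub, ← fst_apply_eq_of_mul_eq zF, hrec, hy, sub_self]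
  -- The intermediate value lies in the domain of `R` because `s * defect r = defect r' * s = defect
  -- r * k * s`.
  · refine (mem_graph_opComp _ _ _ _).mpr ⟨s.fst ((defect r).fst a), ?_, ?_⟩
    · refine (hS.2 _ _).mpr ⟨(defect r).fst a, ?_, rfl⟩
      rw [← fst_apply_eq_of_mul_eq dd.eq]
      exact fst_apply_eq_of_mul_eq heP a
    · refine (hR.2 _ _).mpr ⟨(k * s).fst a, ?_, ?_⟩
      · rw [fst_apply_eq_of_mul_eq sdr, hdk]; rfl
      · rw [← mul_fst_apply, hzP, hcs]; rfl

theorem IsZTransform.smul_normal {T : A →ₗ.[ℂ] A} {z : 𝓜(ℂ, A)} (h : IsZTransform T z)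
    (hT : Dense (T.domain : Set A)) (hz : star z * z = z * star z) {l : ℝ} (hl : 0 < l) :
    ∃ k z' : 𝓜(ℂ, A), IsZTransform ((l : ℂ) • T) z' ∧ z' = (l : ℂ) • (z * k) ∧ Commute k z ∧
      Commute k (defect z) ∧ defect z' = defect z * k ∧ star z' * z' = z' * star z' ∧
      DenseRange (defect z').fst := by
  obtain ⟨k, hk, hkc, hd, hzt⟩ := h.smul hl
  have hkz : Commute k z := hkc z (show star z * z * z = z * (star z * z) by rw [hz, mul_assoc, hz])
  have hkz' : k * star z = star z * k := by
    simpa [hk.star_eq] using (congrArg star hkz.eq).symm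
  refine ⟨k, _, hzt, rfl, hkz, (mul_defect_eq (hkc _ (Commute.refl _))), hd, ?_,
    hzt.denseRange_defect hT⟩
  rw [star_smul, star_mul, hk.star_eq, smul_mul_smul_comm, smul_mul_smul_comm, mul_comm (star _)]
  congr 1
  calc k * star z * (z * k) = k * (star z * z) * k := by simp only [mul_assoc]
    _ = z * k * (k * star z) := by rw [hz, ← mul_assoc, hkz.eq, hkz']; simp only [mul_assoc]

end Closure

end CStarAffiliated

open CStarAffiliated in
theorem mainTheorem3 {A : Type*} [NonUnitalCStarAlgebra A] (p q : ℝ) (hp : 0 < p) (hq : 0 < q)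
    (R S : A →ₗ.[ℂ] A) (hRS : CStarAffiliated.IsCommutingPair p q R S) :
    (CStarAffiliated.opComp R S).IsClosable ∧
      CStarAffiliated.IsAffiliated (CStarAffiliated.opComp R S).closure := by
  let _ := CStarAlgebra.spectralOrder 𝓜(ℂ, A)
  have _ := CStarAlgebra.spectralOrderedRing 𝓜(ℂ, A)
  have zR := zTransform_spec hRS.affiliated_left
  have zS := zTransform_spec hRS.affiliated_right
  have dR := hRS.affiliated_left.1
  have dS := hRS.affiliated_right.1
  have nR := zR.star_mul_self_eq dR hRS.normal_left
  have nS := zS.star_mul_self_eq dS hRS.normal_right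
  obtain ⟨k, r', zR', hk, hkr, hkd, hdk, nR', hdR'⟩ := zR.smul_normal dR nR (div_pos hq hp)
  obtain ⟨-, s', zS', -, -, -, -, nS', hdS'⟩ := zS.smul_normal dS nS (mul_pos hp hq)
  have h1 := hRS.comm_adjoint
  have h2 := hRS.comm
  have zS'' := zS'.opAdjoint dS
  rw [opAdjoint_smul dS (mul_pos hp hq).ne'] at zS''
  rw [zR'.zTransform_eq, zS'.zTransform_eq] at h2
  rw [zR'.zTransform_eq, zS''.zTransform_eq, (zS.opAdjoint dS).zTransform_eq] at h1
  exact isClosable_opComp_and_isAffiliated_closure (div_pos hq hp) zR zS nR nS nR' nS' hk hkr hkd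
    hdk (zR.denseRange_defect dR) (zS.denseRange_defect dS) hdR' hdS' h1 h2
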